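/- Let $p$ be a prime, let $\mathcal O$ be a complete discrete valuation ring with residue field $k$ of characteristic $p$ and quotient field $K$ of characteristic $0$, and let $G$ be a finite group such that $K$ and $k$ are splitting fields for $G$ (every simple $KG$-module and every simple $kG$-module has only scalar endomorphisms). Let $B=\mathcal OGb$ be a block of $\mathcal OG$, where $b$ is a primitive idempotent of $Z(\mathcal OG)$, and let $\chi\in\mathrm{Irr}_K(B)$, that is, $\chi$ is the character of a simple $KG$-module on which $b$ acts as the identity. Let $D$ be a defect group of $B$, that is, a minimal subgroup $D$ of $G$ such that $b=\mathrm{Tr}_D^G(a)=\sum_{x\in G/D}xax^{-1}$ for some $a\in(\mathcal OG)^D$. Suppose that $\chi$ has height zero, that is, the $p$-parts satisfy $\chi(1)_p\cdot |D|_p=|G|_p$. Let $$e(\chi)=\frac{\chi(1)}{|G|}\sum_{g\in G}\chi(g^{-1})\,g\in Z(KG).$$ Then the $\mathcal O$-algebra $A=\mathcal OG\,e(\chi)\subseteq KG$ is symmetric (that is, $A$ is finitely generated projective over $\mathcal O$ and $A\cong\mathrm{Hom}_{\mathcal O}(A,\mathcal O)$ as $A$-$A$-bimodules) if and only if $\chi$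 lifts an irreducible Brauer character, that is, the restriction of $\chi$ to the set of elements of $G$ of order prime to $p$ is the Brauer character of a simple $kG$-module. -/

import Mathlib

open scoped MonoidAlgebra

noncomputable section

namespace BlockTheory

/-! ### Splitting fields and ordinary irreducible characters -/

/-- `F` is a splitting field for `G`: the endomorphism algebra of every simple `FG`-module
consists of the scalars. -/
def IsSplittingFieldFor (F G : Type*) [Field F] [Group G] : Prop :=
  ∀ (n : ℕ) (ρ : Representation F G (Fin n → F)), ρ.IsIrreducible →
    ∀ f : (Fin n → F) →ₗ[F] (Fin n → F), (∀ g, f ∘ₗ ρ g = ρ g ∘ₗ f) →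
      ∃ c : F, f = c • LinearMap.id

/-- `Irr_K(G)`: the characters of the simple `KG`-modules. -/
def IrrK (K G : Type*) [Field K] [Group G] : Set (G → K) :=
  {χ | ∃ (n : ℕ) (ρ : Representation K G (Fin n → K)), ρ.IsIrreducible ∧ ρ.character = χ}

/-! ### The idempotent `e(χ)` and the algebra `OG e(χ)` -/

/-- `e(χ) = (χ(1) / |G|) ∑_g χ(g⁻¹) g` in `KG`. -/
def charIdempotent {K G : Type*} [Field K] [Group G] [Fintype G] (χ : G → K) : K[G] :=
  ∑ g : G, MonoidAlgebra.single g (χ 1 / (Nat.card G : K) * χ g⁻¹)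

section Idempotent

variable {K G : Type*} [Field K] [Group G] [Fintype G]

theorem charIdempotent_conj {χ : G → K} (hχ : χ ∈ IrrK K G) (h : G) :
    MonoidAlgebra.single h 1 * charIdempotent χ = charIdempotent χ * MonoidAlgebra.single h 1 := by
  obtain ⟨n, ρ, -, rfl⟩ := hχ
  simp only [charIdempotent, Finset.mul_sum, Finset.sum_mul, MonoidAlgebra.single_mul_single,
    one_mul, mul_one]
  refine Fintype.sum_equiv (MulAut.conj h).toEquiv _ _ fun g => ?_
  have : ρ.character (h * g⁻¹ * h⁻¹) = ρ.character g⁻¹ := Representation.char_conj ρ _ _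
  simp [← this, mul_assoc]

theorem charIdempotent_comm {χ : G → K} (hχ : χ ∈ IrrK K G) (x : K[G]) :
    charIdempotent χ * x = x * charIdempotent χ := by
  induction x using MonoidAlgebra.induction_on with
  | of g => exact (charIdempotent_conj hχ g).symm
  | add x y hx hy => rw [mul_add, add_mul, hx, hy]
  | smul r x hx => rw [mul_smul_comm, smul_mul_assoc, hx]

/-- On every simple module, `e(χ)` acts as the identity or as zero. -/
theorem asAlgebraHom_charIdempotent [CharZero K] (hK : IsSplittingFieldFor K G)
    {χ : G → K} (hχ : χ ∈ IrrK K G) {n : ℕ} (σ : Representation K G (Fin n → K))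
    (hσ : σ.IsIrreducible) :
    σ.asAlgebraHom (charIdempotent χ) = 0 ∨ σ.asAlgebraHom (charIdempotent χ) = 1 := by
  have hcomm := charIdempotent_conj hχ
  obtain ⟨m, ρ, hρ, rfl⟩ := hχ
  have hG : (Nat.card G : K) ≠ 0 := by exact_mod_cast Nat.card_pos.ne'
  let _ : Invertible (Nat.card G : K) := invertibleOfNonzero hG
  set E := σ.asAlgebraHom (charIdempotent ρ.character) with hE
  obtain ⟨c, hc⟩ := hK n σ hσ E (fun g => by
    have := congrArg σ.asAlgebraHom (hcomm g)
    rw [map_mul, map_mul, Representation.asAlgebraHom_single_one] at this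
    exact this.symm)
  have htr : LinearMap.trace K _ E = ρ.character 1 *
      ((Nat.card G : K)⁻¹ * ∑ g : G, σ.character g * ρ.character g⁻¹) := by
    simp only [hE, charIdempotent, map_sum, Representation.asAlgebraHom_single, map_smul,
      Finset.mul_sum, smul_eq_mul]
    refine Finset.sum_congr rfl fun g _ => ?_
    simp only [Representation.character]
    field_simp
  rw [Representation.card_inv_mul_sum_char_mul_char_eq_finrank] at htr
  have : Nontrivial (Fin n → K) := by
    by_contra hne
    rw [not_nontrivial_iff_subsingleton] at hne
    obtain ⟨a, b, hab⟩ := hσ.toNontrivial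
    exact hab (SetLike.ext fun x => by
      rw [Subsingleton.elim x 0]; exact ⟨fun _ => b.toSubmodule.zero_mem, fun _ => a.toSubmodule.zero_mem⟩)
  have hn : (n : K) ≠ 0 := by
    rintro h0
    have h0 : n = 0 := by exact_mod_cast h0
    subst h0
    exact not_subsingleton (Fin 0 → K) inferInstance
  by_cases hiso : ∀ f : ρ.IntertwiningMap σ, f = 0
  · have : Subsingleton (ρ.IntertwiningMap σ) := ⟨fun a b => by rw [hiso a, hiso b]⟩
    rw [Module.finrank_zero_of_subsingleton, hc] at htr
    left
    simp [hn] at htr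
    rw [hc, htr, zero_smul]
  · push Not at hiso
    obtain ⟨f, hf0⟩ := hiso
    have hf := (Representation.IsIrreducible.bijective_or_eq_zero f).resolve_right hf0
    let φ : ρ.Equiv σ := f.ofBijective hf
    have hone : Module.finrank K (ρ.IntertwiningMap σ) = 1 := by
      refine finrank_eq_one f hf0 fun w => ?_
      obtain ⟨d, hd⟩ := hK n σ hσ (w.toLinearMap ∘ₗ φ.symm.toIntertwiningMap.toLinearMap)
        (fun g => by
          rw [LinearMap.comp_assoc, φ.symm.toIntertwiningMap.isIntertwining',
            ← LinearMap.comp_assoc, w.isIntertwining', LinearMap.comp_assoc])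
      refine ⟨d, ?_⟩
      apply Representation.IntertwiningMap.ext
      ext1 i
      ext1
      have := congrArg (fun l => l (f (LinearMap.single K (fun _ => K) i 1))) hd
      have h2 : φ.symm (φ (LinearMap.single K (fun _ => K) i 1)) =
        LinearMap.single K (fun _ => K) i 1 := φ.toLinearEquiv.symm_apply_apply _
      have h3 : w (φ.symm (φ (LinearMap.single K (fun _ => K) i 1))) =
        d • f (LinearMap.single K (fun _ => K) i 1) := this
      rw [h2] at h3
      exact h3.symm
    right
    rw [hone, hc] at htr
    have hdim : (m : K) = n := by
      have := φ.toLinearEquiv.finrank_eq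
      simp at this
      rw [this]
    simp [hdim] at htr
    have hc1 : c = 1 := mul_right_cancel₀ hn (htr.trans (one_mul _).symm)
    rw [hc, hc1, one_smul]; rfl

/-- An element of `KG` annihilating all simple modules vanishes. -/
theorem eq_zero_of_asAlgebraHom_eq_zero [CharZero K] (x : K[G])
    (hx : ∀ (n : ℕ) (σ : Representation K G (Fin n → K)), σ.IsIrreducible →
      σ.asAlgebraHom x = 0) : x = 0 := by
  have : NeZero (Nat.card G : K) := ⟨by exact_mod_cast Nat.card_pos.ne'⟩
  have key : ∀ S : Submodule K[G] K[G], IsSimpleModule K[G] S → ∀ s ∈ S, x * s = 0 := by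
    intro S hS s hs
    have : FiniteDimensional K S :=
      inferInstanceAs (FiniteDimensional K (S.restrictScalars K))
    let b := (Module.finBasis K S).equivFun
    let φ : K[G] →ₐ[K] Module.End K (Fin (Module.finrank K S) → K) :=
      (b.conjAlgEquiv K : Module.End K S ≃ₐ[K] _).toAlgHom.comp (Algebra.lsmul K K S)
    let σ : Representation K G (Fin (Module.finrank K S) → K) :=
      (φ : K[G] →* _).comp (MonoidAlgebra.of K G)
    have hσφ : σ.asAlgebraHom = φ := by
      apply MonoidAlgebra.algHom_ext' _ (Subsingleton.elim _ _)
      ext1 g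
      simp only [MonoidHom.comp_apply, MonoidAlgebra.of_apply, MonoidHom.coe_coe]
      rw [Representation.asAlgebraHom_single_one]; rfl
    have hirr : σ.IsIrreducible := by
      rw [Representation.irreducible_iff_isSimpleModule_asModule]
      let L : S ≃ₗ[K[G]] σ.asModule :=
        { toFun := fun v => σ.asModuleEquiv.symm (b v)
          invFun := fun v => b.symm (σ.asModuleEquiv v)
          left_inv := fun v => by simp
          right_inv := fun v => by simp
          map_add' := fun v w => by simp
          map_smul' := fun r v => by
            apply σ.asModuleEquiv.injective
            simp [Representation.asModuleEquiv_map_smul, hσφ, φ] }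
      exact IsSimpleModule.congr L.symm
    have h0 := hx _ σ hirr
    rw [hσφ] at h0
    have h1 := congrArg (fun l => b.symm (l (b ⟨s, hs⟩))) h0
    have h2 : x • (⟨s, hs⟩ : S) = 0 := by simpa [φ] using h1
    exact congrArg Subtype.val h2
  have h1 : (1 : K[G]) ∈ sSup {S : Submodule K[G] K[G] | IsSimpleModule K[G] S} := by
    rw [IsSemisimpleModule.sSup_simples_eq_top]; trivial
  have : ∀ y ∈ sSup {S : Submodule K[G] K[G] | IsSimpleModule K[G] S}, x * y = 0 := by
    intro y hy
    rw [sSup_eq_iSup'] at hy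
    induction hy using Submodule.iSup_induction' with
    | mem i z hz => exact key i.1 i.2 z hz
    | zero => exact mul_zero x
    | add a b _ _ ha hb => rw [mul_add, ha, hb, add_zero]
  simpa using this 1 h1

theorem isIdempotentElem_charIdempotent [CharZero K] (hK : IsSplittingFieldFor K G)
    {χ : G → K} (hχ : χ ∈ IrrK K G) : IsIdempotentElem (charIdempotent χ) := by
  rw [IsIdempotentElem, ← sub_eq_zero]
  refine eq_zero_of_asAlgebraHom_eq_zero _ fun n σ hσ => ?_
  rcases asAlgebraHom_charIdempotent hK hχ σ hσ with h | h <;> simp [h]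

end Idempotent

/-- The `O`-algebra `OG e(χ) = {a e(χ) : a ∈ OG}` inside `KG`. Its identity element is `e(χ)`. -/
def charAlgebra (O : Type*) {K G : Type*} [CommRing O] [Field K] [CharZero K] [Algebra O K]
    [Group G] [Fintype G] (hK : IsSplittingFieldFor K G) (χ : G → K) (hχ : χ ∈ IrrK K G) :
    NonUnitalSubalgebra O K[G] where
  carrier := {x | ∃ a : O[G],
    x = MonoidAlgebra.mapRingHom G (algebraMap O K) a * charIdempotent χ}
  zero_mem' := ⟨0, by simp⟩
  add_mem' := by
    rintro _ _ ⟨a, rfl⟩ ⟨b, rfl⟩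
    exact ⟨a + b, by rw [map_add, add_mul]⟩
  mul_mem' := by
    rintro _ _ ⟨a, rfl⟩ ⟨b, rfl⟩
    refine ⟨a * b, ?_⟩
    have h := (isIdempotentElem_charIdempotent hK hχ).eq
    rw [map_mul, mul_assoc, ← mul_assoc (charIdempotent χ), charIdempotent_comm hχ, mul_assoc, h,
      mul_assoc]
  smul_mem' := by
    rintro r _ ⟨a, rfl⟩
    refine ⟨r • a, ?_⟩
    rw [← smul_mul_assoc]
    congr 1
    ext g
    simp [Algebra.smul_def]

/-- An `O`-algebra `A` is symmetric if it is finitely generated projective over `O` and isomorphic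
to `A^∨ = Hom_O(A, O)` as an `A`-`A`-bimodule, where `(a · f · b)(y) = f(b y a)`.
(The definition does not mention the identity element of `A`.) -/
def IsSymmetricAlgebra (O A : Type*) [CommRing O] [NonUnitalRing A] [Module O A] : Prop :=
  Module.Finite O A ∧ Module.Projective O A ∧
    ∃ f : A ≃ₗ[O] Module.Dual O A,
      (∀ a x y : A, f (a * x) y = f x (y * a)) ∧ (∀ x b y : A, f (x * b) y = f x (b * y))

/-! ### Blocks, defect groups and heights -/

/-- `b` is a block idempotent of `OG`, that is, a primitive idempotent of the centre `Z(OG)`;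
the corresponding block algebra is `B = OGb`. -/
def IsBlockIdempotent {O G : Type*} [CommRing O] [Group G] (b : O[G]) : Prop :=
  b ≠ 0 ∧ b ∈ Subring.center O[G] ∧ IsIdempotentElem b ∧
    ∀ c ∈ Subring.center O[G], ∀ d ∈ Subring.center O[G],
      IsIdempotentElem c → IsIdempotentElem d → c * d = 0 → c + d = b → c = 0 ∨ d = 0

/-- `Irr_K(B)` for `B = OGb`: the characters of the simple `KG`-modules on which `b` acts as the
identity. -/
def IrrKBlock {O : Type*} (K : Type*) {G : Type*} [CommRing O] [Field K] [Algebra O K] [Group G]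
    (b : O[G]) : Set (G → K) :=
  {χ | ∃ (n : ℕ) (ρ : Representation K G (Fin n → K)), ρ.IsIrreducible ∧
    ρ.asAlgebraHom (MonoidAlgebra.mapRingHom G (algebraMap O K) b) = 1 ∧ ρ.character = χ}

theorem IrrKBlock_subset {O K G : Type*} [CommRing O] [Field K] [Algebra O K] [Group G]
    (b : O[G]) : IrrKBlock K b ⊆ IrrK K G :=
  fun _ ⟨n, ρ, h, _, hχ⟩ => ⟨n, ρ, h, hχ⟩

/-- `(OG)^D`: the elements of `OG` fixed under conjugation by `D`. -/
def fixedElements (O : Type*) {G : Type*} [CommRing O] [Group G] (D : Subgroup G) : Set O[G] :=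
  {a | ∀ d ∈ D, MonoidAlgebra.of O G d * a * MonoidAlgebra.of O G d⁻¹ = a}

/-- The relative trace `Tr_D^G(a) = ∑_{x ∈ G/D} x a x⁻¹`, which does not depend on the choice of
coset representatives when `a ∈ (OG)^D`. -/
def relTrace {O G : Type*} [CommRing O] [Group G] (D : Subgroup G) (a : O[G]) : O[G] :=
  ∑ᶠ x : G ⧸ D, MonoidAlgebra.of O G x.out * a * MonoidAlgebra.of O G x.out⁻¹

/-- `D` is a defect group of the block `OGb`: a minimal subgroup with `b ∈ Tr_D^G((OG)^D)`. -/
def IsDefectGroup {O G : Type*} [CommRing O] [Group G] (b : O[G]) (D : Subgroup G) : Prop :=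
  Minimal (fun Q : Subgroup G => ∃ a ∈ fixedElements O Q, relTrace Q a = b) D

/-- `χ` has height `h` as a character of the block `OGb` with defect group `D`:
the `p`-part of `χ(1)` is `p^h |G|_p / |D|_p` (note that `D` is a `p`-group). -/
def HasHeight {O K G : Type*} [CommRing O] [Field K] [Group G] (p : ℕ) (b : O[G])
    (χ : G → K) (h : ℕ) : Prop :=
  ∃ D : Subgroup G, IsDefectGroup b D ∧ ∃ n : ℕ, χ 1 = (n : K) ∧
    padicValNat p n + padicValNat p (Nat.card D) = padicValNat p (Nat.card G) + h

/-! ### Brauer characters -/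

/-- `t` is the sum of the lifts to characteristic zero of the eigenvalues of the `k`-linear
endomorphism `f`, where `k` is the residue field of `O` and the eigenvalues of `f` are roots of
unity of order dividing `m` (`m` prime to the characteristic of `k`): `t` is the sum of the roots
(with multiplicities) of the monic polynomial over `O` which reduces to the characteristic
polynomial of `f` and all of whose roots are `m`-th roots of unity. -/
def IsLiftedTrace {O K : Type*} [CommRing O] [IsDomain O] [IsLocalRing O] [Field K] [Algebra O K]
    {n : ℕ}
    (f : Module.End (IsLocalRing.ResidueField O) (Fin n → IsLocalRing.ResidueField O))
    (m : ℕ) (t : K) : Prop :=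
  ∃ F : Polynomial O, F.Monic ∧ F.map (IsLocalRing.residue O) = f.charpoly ∧
    (∀ z ∈ F.aroots (AlgebraicClosure K), z ^ m = 1) ∧
    algebraMap K (AlgebraicClosure K) t = (F.aroots (AlgebraicClosure K)).sum

/-- The set `G_{p'}` of `p'`-elements of `G`. -/
abbrev PRegular (p : ℕ) (G : Type*) [Group G] : Type _ := {g : G // ¬ p ∣ orderOf g}

/-- `IBr_k(G)`: the Brauer characters of the simple `kG`-modules, as functions `G_{p'} → K`. -/
def IBr (O K G : Type*) [CommRing O] [IsDomain O] [IsLocalRing O] [Field K] [Algebra O K]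
    [Group G] (p : ℕ) : Set (PRegular p G → K) :=
  {φ | ∃ (n : ℕ) (ρ : Representation (IsLocalRing.ResidueField O) G
      (Fin n → IsLocalRing.ResidueField O)), ρ.IsIrreducible ∧
    ∀ g : PRegular p G, IsLiftedTrace (ρ g.1) (orderOf g.1) (φ g)}

/-- The decomposition map on functions: restriction to `G_{p'}`. -/
def decompositionMap {K G : Type*} [Group G] (p : ℕ) (χ : G → K) : PRegular p G → K :=
  fun g => χ g.1

/-- `χ` lifts an irreducible Brauer character. -/
def LiftsIrreducibleBrauer (O : Type*) {K G : Type*} [CommRing O] [IsDomain O] [IsLocalRing O]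
    [Field K] [Algebra O K] [Group G] (p : ℕ) (χ : G → K) : Prop :=
  ∃ φ ∈ IBr O K G p, decompositionMap p χ = φ

end BlockTheory

end

open scoped MonoidAlgebra

noncomputable section

namespace BlockTheory

/-! Choose a matrix form `M` over `O` of the representation affording χ. The trace pairing on `n ×
n` matrices over `K` is nondegenerate, so `a e(χ) = 0` exactly when `M(a) = 0`. Hence `OG e(χ)` is
the image Γ of `OG` in `Mₙ(O)`, and both sides of the equivalence turn out to say Γ = `Mₙ(O)`.

Symmetry: `Mₙ(O)` is symmetric through the trace form. Conversely, a symmetrizing form of Γ gives a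
form `s` on `OG` with `s(xy) = s(yx)`, and Schur averaging yields `n s(a) = χ(a) s(1)`. Height zero
supplies `g₀` with `χ(g₀)` a unit: in `χ(1) = |G:D| χ(a)`, obtained from `b = Tr_D^G(a)`, the two
integers have the same `p`-part, so `χ(a)` is a unit, and it is an `O`-combination of values of χ.
Thus `s = d χ` with `d` in `O`. Every functional `tr(X M(·))` has the form `s(w ·)`, which forces `X
= d M(w)`, so `X` lies in Γ (`surjective_of_isSymmetricAlgebra`).

Brauer characters: by Nakayama, Γ = `Mₙ(O)` if and only if the reduction of `M` spans all matrices
over `k`. As `k` is a splitting field, this is detected by traces, which in characteristic `p`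
depend only on `p`-regular elements (`matrixHom_surjective_iff_liftsIrreducibleBrauer`). -/

/-! ### Density, Schur averaging and matrix representations -/

/-- Burnside's theorem: the commutant consists of scalars, so Jacobson density realizes any linear
map on a basis. -/
theorem asAlgebraHom_surjective {F G : Type*} [Field F] [Group G]
    (hF : IsSplittingFieldFor F G) {n : ℕ} (ρ : Representation F G (Fin n → F))
    (hρ : ρ.IsIrreducible) : Function.Surjective ρ.asAlgebraHom := by
  have hend : ∀ f : Module.End F[G] ρ.asModule, ∃ c : F, ∀ x, f x = c • x := by
    intro f
    obtain ⟨c, hc⟩ := hF n ρ hρ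
      (ρ.asModuleEquiv.toLinearMap ∘ₗ f.restrictScalars F ∘ₗ ρ.asModuleEquiv.symm.toLinearMap)
      (fun g => by
        ext1 i
        ext1
        simp only [LinearMap.coe_comp, Function.comp_apply, LinearEquiv.coe_coe,
          Representation.asModuleEquiv_symm_map_rho, LinearMap.coe_restrictScalars, map_smul,
          Representation.asModuleEquiv_map_smul, MonoidAlgebra.of_apply,
          Representation.asAlgebraHom_single_one])
    refine ⟨c, fun x => ?_⟩
    apply ρ.asModuleEquiv.injective
    have := congrArg (fun l => l (ρ.asModuleEquiv x)) hc
    simpa using this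
  intro T
  -- Any `F`-linear map commutes with the commutant, since the latter is scalar.
  let T' : Module.End (Module.End F[G] ρ.asModule) ρ.asModule :=
    { toFun := fun x => ρ.asModuleEquiv.symm (T (ρ.asModuleEquiv x))
      map_add' := fun x y => by simp
      map_smul' := fun f x => by
        obtain ⟨c, hc⟩ := hend f
        simp [hc] }
  classical
  obtain ⟨r, hr⟩ := jacobson_density T'
    (Finset.univ.image fun i => ρ.asModuleEquiv.symm (Pi.basisFun F (Fin n) i))
  refine ⟨r, (Pi.basisFun F (Fin n)).ext fun i => ?_⟩
  have := congrArg ρ.asModuleEquiv (hr _ (Finset.mem_image_of_mem _ (Finset.mem_univ i)))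
  rw [Representation.asModuleEquiv_map_smul] at this
  simpa [T'] using this.symm

/-- The algebra homomorphism `R[G] → Mₙ(R)` attached to a matrix representation. -/
def matrixHom {R G : Type*} [CommRing R] [Group G] {n : ℕ} (M : G →* Matrix (Fin n) (Fin n) R) :
    R[G] →ₐ[R] Matrix (Fin n) (Fin n) R :=
  MonoidAlgebra.lift R _ G M

/-- The matrix representation obtained by applying a ring homomorphism to all entries. -/
def mapRep {R S G : Type*} [CommRing R] [CommRing S] [Group G] {n : ℕ} (f : R →+* S)
    (M : G →* Matrix (Fin n) (Fin n) R) : G →* Matrix (Fin n) (Fin n) S :=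
  (f.mapMatrix : _ →+* Matrix (Fin n) (Fin n) S).toMonoidHom.comp M

section

variable {R S G : Type*} [CommRing R] [CommRing S] [Group G] {n : ℕ}

@[simp]
theorem matrixHom_single (M : G →* Matrix (Fin n) (Fin n) R) (g : G) (r : R) :
    matrixHom M (MonoidAlgebra.single g r) = r • M g := by
  simp [matrixHom]

@[simp]
theorem mapRep_apply (f : R →+* S) (M : G →* Matrix (Fin n) (Fin n) R) (g : G) :
    mapRep f M g = (M g).map f := rfl

theorem matrixHom_mapRingHom (f : R →+* S) (M : G →* Matrix (Fin n) (Fin n) R) (x : R[G]) :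
    matrixHom (mapRep f M) (MonoidAlgebra.mapRingHom G f x) = (matrixHom M x).map f := by
  induction x using MonoidAlgebra.induction_on with
  | of g => simp
  | add x y hx hy => rw [map_add, map_add, hx, hy, map_add, Matrix.map_add _ (map_add f)]
  | smul r x hx =>
    have : MonoidAlgebra.mapRingHom G f (r • x) = f r • MonoidAlgebra.mapRingHom G f x := by
      ext g; simp
    rw [this, map_smul, hx, map_smul]
    ext i j
    simp

theorem eq_zero_of_trace_mul {X : Matrix (Fin n) (Fin n) R}
    (h : ∀ Y, (X * Y).trace = 0) : X = 0 := by
  ext i j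
  simpa [Matrix.trace_mul_single] using h (Matrix.single j i 1)

theorem eq_zero_of_trace_mul_matrixHom {M : G →* Matrix (Fin n) (Fin n) R}
    (hM : Function.Surjective (matrixHom M)) {X : Matrix (Fin n) (Fin n) R}
    (h : ∀ g, (X * M g).trace = 0) : X = 0 := by
  refine eq_zero_of_trace_mul fun Y => ?_
  obtain ⟨y, rfl⟩ := hM Y
  induction y using MonoidAlgebra.induction_on with
  | of g => simpa using h g
  | add x y hx hy => rw [map_add, mul_add, Matrix.trace_add, hx, hy, add_zero]
  | smul r x hx => rw [map_smul, mul_smul_comm, Matrix.trace_smul, hx, smul_zero]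

/-- Averaging over the group: Schur's lemma for a matrix representation spanning all matrices. -/
theorem card_smul_sum_conj [Fintype G] {M : G →* Matrix (Fin n) (Fin n) R}
    (hM : Function.Surjective (matrixHom M)) (X : Matrix (Fin n) (Fin n) R) :
    (n : R) • ∑ g, M g * X * M g⁻¹ = ((Fintype.card G : R) * X.trace) • 1 := by
  set Z := ∑ g, M g * X * M g⁻¹ with hZ
  have hcomm : ∀ h, M h * Z = Z * M h := by
    intro h
    rw [hZ, Finset.mul_sum, Finset.sum_mul]
    refine Fintype.sum_equiv (Equiv.mulLeft h) _ _ fun g => ?_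
    simp only [Equiv.coe_mulLeft, mul_inv_rev, map_mul, mul_assoc, ← map_mul M h⁻¹ h,
      inv_mul_cancel, map_one, mul_one]
  have hall : ∀ Y, Commute Z Y := by
    intro Y
    obtain ⟨y, rfl⟩ := hM Y
    induction y using MonoidAlgebra.induction_on with
    | of g => rw [MonoidAlgebra.of_apply, matrixHom_single, one_smul]; exact (hcomm g).symm
    | add x y hx hy => rw [map_add]; exact hx.add_right hy
    | smul r x hx => rw [map_smul]; exact hx.smul_right r
  obtain ⟨r, hr⟩ := Matrix.mem_range_scalar_of_commute_single (M := Z) fun i j _ =>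
    (hall (Matrix.single i j 1)).symm
  have htr : Z.trace = Fintype.card G * X.trace := by
    have : ∀ g, (M g * X * M g⁻¹).trace = X.trace := fun g => by
      rw [Matrix.trace_mul_cycle, ← map_mul, inv_mul_cancel, map_one, one_mul]
    simp [hZ, Matrix.trace_sum, this]
  -- The factor `n` in the statement avoids dividing by `n` in `R`.
  have : Z.trace = n * r := by
    rw [← hr]; simp [Matrix.trace, mul_comm]
  rw [← htr, this, ← hr]
  ext i j
  simp [Matrix.one_apply, Matrix.diagonal_apply]

/-- The matrix representation attached to a representation on `Rⁿ`. -/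
def toMatrixRep (ρ : Representation R G (Fin n → R)) : G →* Matrix (Fin n) (Fin n) R :=
  (LinearMap.toMatrixAlgEquiv' : _ ≃ₐ[R] Matrix (Fin n) (Fin n) R).toAlgHom.toRingHom.toMonoidHom.comp ρ

theorem toMatrixRep_apply (ρ : Representation R G (Fin n → R)) (g : G) :
    toMatrixRep ρ g = LinearMap.toMatrixAlgEquiv' (ρ g) := rfl

theorem matrixHom_toMatrixRep (ρ : Representation R G (Fin n → R)) (x : R[G]) :
    matrixHom (toMatrixRep ρ) x = LinearMap.toMatrixAlgEquiv' (ρ.asAlgebraHom x) := by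
  induction x using MonoidAlgebra.induction_on with
  | of g => simp [toMatrixRep_apply]
  | add x y hx hy => simp only [map_add, hx, hy]
  | smul r x hx => simp only [map_smul, hx]

theorem trace_toMatrixRep {F : Type*} [Field F] (ρ : Representation F G (Fin n → F)) (g : G) :
    (toMatrixRep ρ g).trace = ρ.character g := by
  rw [toMatrixRep_apply, Representation.character, LinearMap.trace_eq_matrix_trace F (Pi.basisFun F (Fin n))]
  rfl

theorem matrixHom_toMatrixRep_surjective {F : Type*} [Field F]
    (hF : IsSplittingFieldFor F G) (ρ : Representation F G (Fin n → F))
    (hρ : ρ.IsIrreducible) : Function.Surjective (matrixHom (toMatrixRep ρ)) := by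
  intro X
  obtain ⟨x, hx⟩ := asAlgebraHom_surjective hF ρ hρ (LinearMap.toMatrixAlgEquiv'.symm X)
  exact ⟨x, by rw [matrixHom_toMatrixRep, hx, AlgEquiv.apply_symm_apply]⟩

/-- The representation on `Rⁿ` attached to a matrix representation. -/
def ofMatrixRep (M : G →* Matrix (Fin n) (Fin n) R) : Representation R G (Fin n → R) :=
  (Matrix.toLinAlgEquiv' : Matrix (Fin n) (Fin n) R ≃ₐ[R] _).toAlgHom.toRingHom.toMonoidHom.comp M

theorem ofMatrixRep_apply (M : G →* Matrix (Fin n) (Fin n) R) (g : G) :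
    ofMatrixRep M g = Matrix.toLinAlgEquiv' (M g) := rfl

theorem isIrreducible_ofMatrixRep {F : Type*} [Field F] (hn : n ≠ 0)
    {M : G →* Matrix (Fin n) (Fin n) F} (hM : Function.Surjective (matrixHom M)) :
    (ofMatrixRep M).IsIrreducible := by
  have hstab : ∀ (W : Subrepresentation (ofMatrixRep M)) (x : F[G]) (w : Fin n → F),
      w ∈ W.toSubmodule → (matrixHom M x).mulVec w ∈ W.toSubmodule := by
    intro W x w hw
    induction x using MonoidAlgebra.induction_on with
    | of g => simpa [ofMatrixRep_apply] using W.apply_mem_toSubmodule g hw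
    | add x y hx hy => rw [map_add, Matrix.add_mulVec]; exact W.toSubmodule.add_mem hx hy
    | smul r x hx => rw [map_smul, Matrix.smul_mulVec]; exact W.toSubmodule.smul_mem r hx
  have : NeZero n := ⟨hn⟩
  refine { exists_pair_ne := ⟨⊥, ⊤, fun h => ?_⟩, eq_bot_or_eq_top := fun W => ?_ }
  · have h1 : (⊥ : Submodule F (Fin n → F)) = ⊤ :=
      congrArg Subrepresentation.toSubmodule h
    exact bot_ne_top h1
  · by_cases hW : W.toSubmodule = ⊥
    · exact .inl (Subrepresentation.toSubmodule_injective hW)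
    · right
      obtain ⟨w, hw, hw0⟩ := W.toSubmodule.exists_mem_ne_zero_of_ne_bot hW
      obtain ⟨i, hi⟩ := Function.ne_iff.mp hw0
      refine Subrepresentation.toSubmodule_injective (Submodule.eq_top_iff'.mpr fun v => ?_)
      -- This matrix is supported on column `i` and sends `w` to `v`.
      obtain ⟨x, hx⟩ := hM (Matrix.of fun a b => if b = i then v a * (w i)⁻¹ else 0)
      have := hstab W x w hw
      rw [hx] at this
      convert this
      ext a
      have hi' : w i ≠ 0 := hi
      simp [Matrix.mulVec, dotProduct, hi']

end

/-! ### Traces and `p`-regular parts -/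

/-- In characteristic `p`, the trace of a matrix representation only depends on its restriction
to `p`-regular elements. -/
theorem trace_eq_of_pRegular {F G : Type*} [Field F] [Group G] [Finite G] (p : ℕ) [Fact p.Prime]
    [CharP F p] (g : G) :
    ∃ h : G, ¬ p ∣ orderOf h ∧ ∀ (n : ℕ) (M : G →* Matrix (Fin n) (Fin n) F),
      (M g).trace = (M h).trace := by
  obtain ⟨a, m, hm, hgm⟩ := Nat.exists_eq_pow_mul_and_not_dvd (orderOf_pos g).ne' p
    (Fact.out : p.Prime).ne_one
  have hco : Nat.Coprime (p ^ a) m :=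
    Nat.Coprime.pow_left _ (((Fact.out : p.Prime).coprime_iff_not_dvd).mpr hm)
  -- With `j ≡ 0` mod `p ^ a` and `j ≡ 1` mod `m`, `g ^ j` is the `p'`-part of `g`.
  obtain ⟨j, hj0, hj1⟩ := Nat.chineseRemainder hco 0 1
  have hhm : (g ^ j) ^ m = 1 := by
    rw [← pow_mul]
    apply orderOf_dvd_iff_pow_eq_one.mp
    rw [hgm]
    exact Nat.mul_dvd_mul_right (Nat.modEq_zero_iff_dvd.mp hj0) m
  refine ⟨g ^ j, fun hd => hm (hd.trans (orderOf_dvd_of_pow_eq_one hhm)), fun n M => ?_⟩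
  have hpow : g ^ p ^ a = (g ^ j) ^ p ^ a := by
    rw [← pow_mul, pow_eq_pow_iff_modEq, hgm, mul_comm j]
    simpa using hj1.symm.mul_left' (p ^ a)
  have hcomm : Commute (M g) (M (g ^ j)) := by
    rw [map_pow]; exact Commute.pow_right rfl j
  -- The two matrices commute and have equal `p ^ a`-th powers, so Frobenius kills their difference.
  have hnil : IsNilpotent (M g - M (g ^ j)) := by
    refine ⟨p ^ a, ?_⟩
    rcases n.eq_zero_or_pos with rfl | hn
    · exact Subsingleton.elim _ _
    have : NeZero n := ⟨hn.ne'⟩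
    rw [sub_pow_char_pow_of_commute _ _ hcomm, ← map_pow, ← map_pow, hpow, sub_self]
  have := (Matrix.isNilpotent_trace_of_isNilpotent hnil).eq_zero
  rwa [Matrix.trace_sub, sub_eq_zero] at this

/-! ### Integral forms -/

/-- A representation over the fraction field of a principal ideal domain is defined over that
domain. -/
theorem exists_integral_form (O : Type*) {K G : Type*} [CommRing O] [IsDomain O]
    [IsPrincipalIdealRing O] [Field K] [Algebra O K] [IsFractionRing O K] [Group G] [Finite G]
    {n : ℕ} (ρ : Representation K G (Fin n → K)) :
    ∃ (M : G →* Matrix (Fin n) (Fin n) O) (c : Module.Basis (Fin n) K (Fin n → K)),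
      ∀ g, LinearMap.toMatrixAlgEquiv c (ρ g) = (M g).map (algebraMap O K) := by
  -- The `O`-span of the `G`-translates of the standard basis is a `G`-stable lattice, hence free
  -- over a principal ideal domain.
  let L : Submodule O (Fin n → K) :=
    Submodule.span O (Set.range fun x : G × Fin n => ρ x.1 (Pi.basisFun K (Fin n) x.2))
  have hL : ∀ g, ∀ v ∈ L, ρ g v ∈ L := by
    intro g v hv
    induction hv using Submodule.span_induction with
    | mem v hv =>
      obtain ⟨⟨h, i⟩, rfl⟩ := hv
      exact Submodule.subset_span ⟨(g * h, i), by simp⟩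
    | zero => rw [map_zero]; exact L.zero_mem
    | add v w _ _ hv hw => rw [map_add]; exact L.add_mem hv hw
    | smul r v _ hv => rw [LinearMap.map_smul_of_tower]; exact L.smul_mem r hv
  have : Submodule.IsLattice K L :=
    { fg := Submodule.fg_span (Set.finite_range _)
      span_eq_top := by
        refine eq_top_iff.mpr ?_
        rw [← (Pi.basisFun K (Fin n)).span_eq]
        refine Submodule.span_mono ?_
        rintro _ ⟨i, rfl⟩
        exact Submodule.subset_span ⟨(1, i), by simp⟩ }
  have : Module.IsTorsionFree O K := inferInstance
  have : Module.Free O L := Submodule.IsLattice.free (K := K) L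
  let b : Module.Basis (Fin n) O L := (Module.finBasisOfFinrankEq O L (by
    rw [Submodule.IsLattice.finrank_of_pi K L, Fintype.card_fin]))
  let c := b.extendOfIsLattice K
  have hc : ∀ i, c i = (b i).1 := fun i => Module.Basis.extendOfIsLattice_apply K b i
  let ρL : G → Module.End O L := fun g => ((ρ g).restrictScalars O).restrict (hL g)
  have hcρ : ∀ g, LinearMap.toMatrixAlgEquiv c (ρ g) =
      (LinearMap.toMatrixAlgEquiv b (ρL g)).map (algebraMap O K) := by
    intro g
    ext i j
    rw [LinearMap.toMatrixAlgEquiv_apply, Matrix.map_apply, LinearMap.toMatrixAlgEquiv_apply, hc]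
    have h1 : ρ g (b j).1 = (ρL g (b j)).1 := rfl
    rw [h1]
    generalize ρL g (b j) = w
    have h2 : w.1 = ∑ i, algebraMap O K (b.repr w i) • c i := by
      conv_lhs => rw [← b.sum_repr w]
      simp only [Submodule.coe_sum, Submodule.coe_smul, hc, algebraMap_smul]
    rw [h2, map_sum, Finsupp.finsetSum_apply]
    simp only [map_smul, Module.Basis.repr_self, Finsupp.smul_apply, Finsupp.single_apply,
      smul_eq_mul, mul_ite, mul_one, mul_zero, Finset.sum_ite_eq', Finset.mem_univ, if_true]
  refine ⟨{ toFun := fun g => LinearMap.toMatrixAlgEquiv b (ρL g), map_one' := ?_,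
            map_mul' := fun g h => ?_ }, c, hcρ⟩
  · rw [← map_one (LinearMap.toMatrixAlgEquiv b)]
    congr 1
    ext x
    simp [ρL]
  · rw [← map_mul]
    congr 1
    refine LinearMap.ext fun x => Subtype.ext ?_
    exact LinearMap.congr_fun (map_mul ρ g h) x.1

theorem exists_matrixRep (O : Type*) {K G : Type*} [CommRing O] [IsDomain O]
    [IsPrincipalIdealRing O] [Field K] [Algebra O K] [IsFractionRing O K] [Group G] [Finite G]
    (hK : IsSplittingFieldFor K G) {n : ℕ} (ρ : Representation K G (Fin n → K))
    (hρ : ρ.IsIrreducible) :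
    ∃ M : G →* Matrix (Fin n) (Fin n) O,
      Function.Surjective (matrixHom (mapRep (algebraMap O K) M)) ∧
      ∀ g, ρ.character g = algebraMap O K (M g).trace := by
  obtain ⟨M, c, hM⟩ := exists_integral_form O ρ
  have hall : ∀ x, matrixHom (mapRep (algebraMap O K) M) x =
      LinearMap.toMatrixAlgEquiv c (ρ.asAlgebraHom x) := by
    intro x
    induction x using MonoidAlgebra.induction_on with
    | of g => simp [hM]
    | add x y hx hy => simp only [map_add, hx, hy]
    | smul r x hx => simp only [map_smul, hx]
  refine ⟨M, fun X => ?_, fun g => ?_⟩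
  · obtain ⟨x, hx⟩ := asAlgebraHom_surjective hK ρ hρ ((LinearMap.toMatrixAlgEquiv c).symm X)
    exact ⟨x, by rw [hall, hx, AlgEquiv.apply_symm_apply]⟩
  · rw [Representation.character, LinearMap.trace_eq_matrix_trace K c]
    change (LinearMap.toMatrixAlgEquiv c (ρ g)).trace = _
    rw [hM]
    exact (AddMonoidHom.map_trace (algebraMap O K) (M g)).symm

/-! ### The kernel of `OG → OG e(χ)` -/

theorem charIdempotent_coeff {K G : Type*} [Field K] [Group G] [Fintype G] (χ : G → K) (g : G) :
    (charIdempotent χ).coeff g = χ 1 / (Nat.card G : K) * χ g⁻¹ := by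
  classical
  simp only [charIdempotent, MonoidAlgebra.coeff_sum, MonoidAlgebra.coeff_single,
    Finsupp.finsetSum_apply, Finsupp.single_apply, Finset.sum_ite_eq', Finset.mem_univ, if_true]

theorem coeff_mul_charIdempotent {O K G : Type*} [CommRing O] [Field K] [Algebra O K] [Group G]
    [Fintype G] {n : ℕ} {χ : G → K} {M : G →* Matrix (Fin n) (Fin n) O}
    (hχ : ∀ g, χ g = algebraMap O K (M g).trace) (a : O[G]) (h : G) :
    (MonoidAlgebra.mapRingHom G (algebraMap O K) a * charIdempotent χ).coeff h =
      χ 1 / (Nat.card G : K) * algebraMap O K (matrixHom M a * M h⁻¹).trace := by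
  induction a using MonoidAlgebra.induction_on with
  | of g =>
    simp only [MonoidAlgebra.of_apply, MonoidAlgebra.mapRingHom_single, map_one,
      matrixHom_single, one_smul, MonoidAlgebra.coeff_single_mul_apply, charIdempotent_coeff, one_mul]
    have hχ' : χ (h⁻¹ * g) = algebraMap O K (M g * M h⁻¹).trace := by
      rw [hχ, map_mul, Matrix.trace_mul_comm]
    rw [← hχ', mul_inv_rev, inv_inv]
  | add x y hx hy =>
    rw [map_add, add_mul, MonoidAlgebra.coeff_add, Finsupp.add_apply, hx, hy, map_add, add_mul,
      Matrix.trace_add, map_add, mul_add]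
  | smul r x hx =>
    have : MonoidAlgebra.mapRingHom G (algebraMap O K) (r • x) =
        algebraMap O K r • MonoidAlgebra.mapRingHom G (algebraMap O K) x := by
      ext g; simp [Algebra.smul_def]
    rw [this, smul_mul_assoc, MonoidAlgebra.coeff_smul, Finsupp.smul_apply, hx, map_smul,
      smul_mul_assoc, Matrix.trace_smul, smul_eq_mul, smul_eq_mul, map_mul]
    ring

/-- The coefficients of `a e(χ)` are nonzero multiples of the traces of `M(a) M(g)`, and the `M(g)`
span all matrices over `K`. -/
theorem mul_charIdempotent_eq_zero_iff {O K G : Type*} [CommRing O] [Field K] [CharZero K]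
    [Algebra O K] [FaithfulSMul O K] [Group G] [Fintype G] {n : ℕ} (hn : n ≠ 0) {χ : G → K}
    {M : G →* Matrix (Fin n) (Fin n) O}
    (hM : Function.Surjective (matrixHom (mapRep (algebraMap O K) M)))
    (hχ : ∀ g, χ g = algebraMap O K (M g).trace) (a : O[G]) :
    MonoidAlgebra.mapRingHom G (algebraMap O K) a * charIdempotent χ = 0 ↔ matrixHom M a = 0 := by
  have hinj := FaithfulSMul.algebraMap_injective O K
  constructor
  · intro h
    have h1 : ∀ g, algebraMap O K (matrixHom M a * M g).trace = 0 := by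
      intro g
      have := coeff_mul_charIdempotent hχ a g⁻¹
      rw [h, inv_inv, hχ 1] at this
      simpa [hn, Nat.card_pos.ne'] using this.symm
    apply Matrix.map_injective hinj
    dsimp only
    rw [Matrix.map_zero _ (map_zero _)]
    refine eq_zero_of_trace_mul_matrixHom hM fun g => ?_
    rw [mapRep_apply, ← Matrix.map_mul]
    exact (AddMonoidHom.map_trace (algebraMap O K) _).symm.trans (h1 g)
  · intro h
    ext g
    rw [coeff_mul_charIdempotent hχ, h]
    simp

/-! ### Symmetric algebras and full matrix algebras -/

/-- If `OG e(χ)`, realised as a quotient of `OG` by the kernel of a matrix representation `M`,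
is all of `Mₙ(O)`, then it is symmetric via the trace form. -/
theorem isSymmetricAlgebra_of_surjective {O G A : Type*} [CommRing O] [Group G] [NonUnitalRing A]
    [Module O A] {n : ℕ} {M : G →* Matrix (Fin n) (Fin n) O} (Ψ : O[G] →ₗ[O] A)
    (hΨ : Function.Surjective Ψ) (hmul : ∀ a b, Ψ (a * b) = Ψ a * Ψ b)
    (hker : ∀ a, Ψ a = 0 ↔ matrixHom M a = 0) (hM : Function.Surjective (matrixHom M)) :
    IsSymmetricAlgebra O A := by
  have hk : Ψ.ker = (matrixHom M).toLinearMap.ker := by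
    ext a; exact hker a
  let θ : A ≃ₗ[O] Matrix (Fin n) (Fin n) O :=
    (Ψ.quotKerEquivOfSurjective hΨ).symm ≪≫ₗ (Submodule.quotEquivOfEq _ _ hk) ≪≫ₗ
      ((matrixHom M).toLinearMap.quotKerEquivOfSurjective hM)
  have hθ : ∀ a, θ (Ψ a) = matrixHom M a := by
    intro a
    have : (Ψ.quotKerEquivOfSurjective hΨ).symm (Ψ a) = Ψ.ker.mkQ a := by
      rw [LinearEquiv.symm_apply_eq]; rfl
    simp only [θ, LinearEquiv.trans_apply, this]
    rfl
  have hθmul : ∀ x y, θ (x * y) = θ x * θ y := by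
    intro x y
    obtain ⟨a, rfl⟩ := hΨ x
    obtain ⟨b, rfl⟩ := hΨ y
    rw [← hmul, hθ, hθ, hθ, map_mul]
  let τ : Matrix (Fin n) (Fin n) O →ₗ[O] Module.Dual O A :=
    LinearMap.mk₂ O (fun X y => (X * θ y).trace) (fun X X' y => by simp [add_mul])
      (fun r X y => by simp) (fun X y y' => by simp [mul_add]) (fun r X y => by simp)
  have hτ : Function.Bijective τ := by
    constructor
    · rw [injective_iff_map_eq_zero]
      intro X hX
      refine eq_zero_of_trace_mul fun Y => ?_
      have := LinearMap.congr_fun hX (θ.symm Y)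
      simpa [τ] using this
    · intro ℓ
      -- Pairing `X` with the matrix unit at `(j, i)` under the trace reads off the entry `X i j`,
      -- hence the transposed indices.
      refine ⟨Matrix.of fun i j => ℓ (θ.symm (Matrix.single j i 1)), ?_⟩
      have : τ (Matrix.of fun i j => ℓ (θ.symm (Matrix.single j i 1))) ∘ₗ θ.symm.toLinearMap =
          ℓ ∘ₗ θ.symm.toLinearMap := by
        refine (Matrix.stdBasis O (Fin n) (Fin n)).ext fun ⟨i, j⟩ => ?_
        simp [τ, Matrix.stdBasis_eq_single, Matrix.trace_mul_single]
      ext x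
      simpa using LinearMap.congr_fun this (θ x)
  refine ⟨Module.Finite.equiv θ.symm, Module.Projective.of_equiv θ.symm,
    θ ≪≫ₗ LinearEquiv.ofBijective τ hτ, fun a x y => ?_, fun x b y => ?_⟩
  · simp only [LinearEquiv.trans_apply, LinearEquiv.ofBijective_apply, τ, LinearMap.mk₂_apply,
      hθmul]
    rw [mul_assoc, Matrix.trace_mul_comm, mul_assoc]
  · simp [τ, hθmul, mul_assoc]

/-- If `OG e(χ)` is symmetric and `χ` takes a unit value, then `OG e(χ)` is a full matrix
algebra. -/
theorem surjective_of_isSymmetricAlgebra {O K G A : Type*} [CommRing O] [IsDomain O] [Field K]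
    [CharZero K] [Algebra O K] [FaithfulSMul O K] [Group G] [Fintype G] [NonUnitalRing A]
    [Module O A] {n : ℕ} (hn : n ≠ 0) {M : G →* Matrix (Fin n) (Fin n) O}
    (hMK : Function.Surjective (matrixHom (mapRep (algebraMap O K) M)))
    (Ψ : O[G] →ₗ[O] A)
    (hΨ : Function.Surjective Ψ) (hmul : ∀ a b, Ψ (a * b) = Ψ a * Ψ b)
    (hker : ∀ a, Ψ a = 0 ↔ matrixHom M a = 0) {g₀ : G} (hg₀ : IsUnit (M g₀).trace)
    (hA : IsSymmetricAlgebra O A) : Function.Surjective (matrixHom M) := by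
  obtain ⟨-, -, f, hfl, hfr⟩ := hA
  have hinj := FaithfulSMul.algebraMap_injective O K
  have : CharZero O := ⟨fun a b h => by
    have := congrArg (algebraMap O K) h
    simpa using this⟩
  -- The symmetrizing form pulled back to `OG`; the bimodule identities give `s(ab) = s(ba)`.
  let s : O[G] →ₗ[O] O := f (Ψ 1) ∘ₗ Ψ
  have hs1 : ∀ a b, s (a * b) = f (Ψ a) (Ψ b) := fun a b => by
    simp only [s, LinearMap.comp_apply, hmul, ← hfr]
    rw [← hmul, one_mul]
  have hs2 : ∀ a b, s (a * b) = s (b * a) := fun a b => by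
    rw [hs1 b a]
    simp only [s, LinearMap.comp_apply, hmul, ← hfl]
    rw [← hmul, mul_one]
  have hs0 : ∀ a b, matrixHom M a = matrixHom M b → s a = s b := by
    intro a b h
    rw [← sub_eq_zero, ← map_sub, ← hker, map_sub, sub_eq_zero] at h
    simp only [s, LinearMap.comp_apply, h]
  have hconj : ∀ a : O[G], s (∑ g, MonoidAlgebra.single g 1 * a * MonoidAlgebra.single g⁻¹ 1) =
      Fintype.card G * s a := by
    intro a
    have : ∀ g : G, s (MonoidAlgebra.single g 1 * a * MonoidAlgebra.single g⁻¹ 1) = s a := by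
      intro g
      rw [hs2, ← mul_assoc, MonoidAlgebra.single_mul_single, inv_mul_cancel, one_mul,
        ← MonoidAlgebra.one_def, one_mul]
    simp [map_sum, this]
  -- `M` is only known to span over `K`, so Schur averaging is done there and descends by
  -- injectivity of `O → K`.
  have hschur : ∀ X : Matrix (Fin n) (Fin n) O,
      (n : O) • ∑ g, M g * X * M g⁻¹ = ((Fintype.card G : O) * X.trace) • 1 := by
    intro X
    have h := card_smul_sum_conj hMK (X.map (algebraMap O K))
    apply Matrix.map_injective hinj
    have h1 : (X.map (algebraMap O K)).trace = algebraMap O K X.trace :=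
      (AddMonoidHom.map_trace (algebraMap O K) X).symm
    rw [h1] at h
    have h2 : ∀ Y : Matrix (Fin n) (Fin n) O, Y.map (algebraMap O K) =
      (algebraMap O K).mapMatrix Y := fun _ => rfl
    simp only [mapRep_apply, h2, ← map_mul _ (M _), ← map_mul _ (M _ * X), ← map_sum] at h
    ext i j
    have := congrFun (congrFun h i) j
    simp only [Matrix.smul_apply, RingHom.mapMatrix_apply, Matrix.map_apply, smul_eq_mul] at this
    simpa [Matrix.one_apply, apply_ite (algebraMap O K)] using this
  have hn' : (n : O) ≠ 0 := by exact_mod_cast hn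
  have hcard : (Fintype.card G : O) ≠ 0 := by exact_mod_cast Fintype.card_ne_zero
  -- Apply `s` to the Schur identity for `X = M(a)` and cancel `|G|`.
  have hs : ∀ a, (n : O) * s a = (matrixHom M a).trace * s 1 := by
    intro a
    have h1 : matrixHom M ((n : O) • ∑ g : G,
        MonoidAlgebra.single g 1 * a * MonoidAlgebra.single g⁻¹ 1) =
        matrixHom M (((Fintype.card G : O) * (matrixHom M a).trace) • 1) := by
      rw [map_smul, map_smul, map_one, ← hschur]
      simp
    have h2 := hs0 _ _ h1
    rw [map_smul, map_smul, hconj, smul_eq_mul, smul_eq_mul] at h2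
    apply mul_left_cancel₀ hcard
    linear_combination h2
  obtain ⟨u, hu⟩ := hg₀
  -- The ratio `s(g₀) / χ(g₀)` lies in `O` because `χ(g₀)` is a unit.
  let d := (u⁻¹ : Oˣ) * s (MonoidAlgebra.single g₀ 1)
  have hd : ∀ a, s a = d * (matrixHom M a).trace := by
    intro a
    have h1 := hs (MonoidAlgebra.single g₀ 1)
    rw [matrixHom_single, one_smul, ← hu] at h1
    have h2 : s 1 = n * d := by
      simp only [d]
      rw [mul_left_comm, h1, ← mul_assoc, Units.inv_mul, one_mul]
    apply mul_left_cancel₀ hn'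
    rw [hs, h2]
    ring
  intro X
  have hk : Ψ.ker ≤ ((Matrix.traceLinearMap (Fin n) O O) ∘ₗ (LinearMap.mulLeft O X) ∘ₗ
      (matrixHom M).toLinearMap).ker := by
    intro a ha
    have : matrixHom M a = 0 := (hker a).mp ha
    simp [this]
  -- The functional `tr(X M(·))` vanishes on the kernel of `Ψ`, so it descends to `A`.
  let ℓ : Module.Dual O A :=
    (Ψ.ker.liftQ _ hk) ∘ₗ (Ψ.quotKerEquivOfSurjective hΨ).symm.toLinearMap
  have hℓ : ∀ a, ℓ (Ψ a) = (X * matrixHom M a).trace := by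
    intro a
    have : (Ψ.quotKerEquivOfSurjective hΨ).symm (Ψ a) = Ψ.ker.mkQ a := by
      rw [LinearEquiv.symm_apply_eq]; rfl
    simp [ℓ, this]
  obtain ⟨w, hw⟩ := f.surjective ℓ
  obtain ⟨w, rfl⟩ := hΨ w
  -- If `w` represents `ℓ`, then `tr(X M(g)) = s(w g) = d tr(M(w) M(g))` for all `g`; nondegeneracy
  -- gives `X = d M(w)`.
  refine ⟨d • w, ?_⟩
  rw [eq_comm, ← sub_eq_zero]
  apply Matrix.map_injective hinj
  dsimp only
  rw [Matrix.map_zero _ (map_zero _)]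
  refine eq_zero_of_trace_mul_matrixHom hMK fun g => ?_
  rw [mapRep_apply, ← Matrix.map_mul]
  refine (AddMonoidHom.map_trace (algebraMap O K) _).symm.trans ?_
  have h1 := hℓ (MonoidAlgebra.single g 1)
  rw [← hw, ← hs1, hd, map_mul, matrixHom_single, one_smul] at h1
  simp [sub_mul, h1]

theorem map_trace_eq {R S : Type*} [CommRing R] [CommRing S] {n : ℕ} (f : R →+* S)
    (X : Matrix (Fin n) (Fin n) R) : (X.map f).trace = f X.trace :=
  (AddMonoidHom.map_trace f X).symm

/-! ### Reduction modulo the maximal ideal -/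

section Reduction

open IsLocalRing

variable {O G : Type*} [CommRing O] [IsLocalRing O] [Group G] {n : ℕ}

theorem matrixHom_residue_surjective {M : G →* Matrix (Fin n) (Fin n) O}
    (hM : Function.Surjective (matrixHom M)) :
    Function.Surjective (matrixHom (mapRep (residue O) M)) := by
  intro X
  choose r hr using residue_surjective (R := O)
  obtain ⟨a, ha⟩ := hM (X.map r)
  refine ⟨MonoidAlgebra.mapRingHom G (residue O) a, ?_⟩
  rw [matrixHom_mapRingHom, ha]
  ext i j
  simp [hr]

theorem mapRingHom_residue_surjective :
    Function.Surjective (MonoidAlgebra.mapRingHom G (residue O)) := by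
  intro x
  induction x using MonoidAlgebra.induction_on with
  | of g => exact ⟨MonoidAlgebra.of O G g, by simp⟩
  | add x y hx hy =>
    obtain ⟨a, rfl⟩ := hx
    obtain ⟨b, rfl⟩ := hy
    exact ⟨a + b, map_add _ _ _⟩
  | smul r x hx =>
    obtain ⟨a, rfl⟩ := hx
    obtain ⟨s, rfl⟩ := residue_surjective r
    exact ⟨s • a, by ext g; simp⟩

/-- Nakayama's lemma: each matrix agrees with one in the image up to entries in the maximal ideal.
-/
theorem matrixHom_surjective_of_residue {M : G →* Matrix (Fin n) (Fin n) O}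
    (hM : Function.Surjective (matrixHom (mapRep (residue O) M))) :
    Function.Surjective (matrixHom M) := by
  have key : (⊤ : Submodule O (Matrix (Fin n) (Fin n) O)) ≤ (matrixHom M).toLinearMap.range := by
    refine Submodule.le_of_le_smul_of_le_jacobson_bot (I := maximalIdeal O)
      Module.Finite.fg_top (maximalIdeal_le_jacobson _) fun Y _ => ?_
    obtain ⟨x, hx⟩ := hM (Y.map (residue O))
    obtain ⟨a, rfl⟩ := mapRingHom_residue_surjective x
    rw [matrixHom_mapRingHom] at hx
    rw [← add_sub_cancel (matrixHom M a) Y]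
    refine Submodule.add_mem_sup ⟨a, rfl⟩ ?_
    rw [Matrix.matrix_eq_sum_single (Y - matrixHom M a)]
    refine Submodule.sum_mem _ fun i _ => Submodule.sum_mem _ fun j _ => ?_
    rw [← mul_one ((Y - matrixHom M a) i j), ← smul_eq_mul, ← Matrix.smul_single]
    refine Submodule.smul_mem_smul ?_ trivial
    rw [← residue_eq_zero_iff, Matrix.sub_apply, map_sub, sub_eq_zero]
    exact (congrFun (congrFun hx i) j).symm
  exact fun Y => key (Submodule.mem_top (x := Y))

/-- A matrix representation over a field with the same traces as a representation spanning all
matrices also spans all matrices. -/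
theorem matrixHom_surjective_of_trace_eq {F : Type*} [Field F] [Finite G]
    {M N : G →* Matrix (Fin n) (Fin n) F} (hN : Function.Surjective (matrixHom N))
    (h : ∀ g, (M g).trace = (N g).trace) : Function.Surjective (matrixHom M) := by
  have htr : ∀ x, (matrixHom M x).trace = (matrixHom N x).trace := by
    intro x
    induction x using MonoidAlgebra.induction_on with
    | of g => simpa using h g
    | add x y hx hy => simp only [map_add, Matrix.trace_add, hx, hy]
    | smul r x hx => simp only [map_smul, Matrix.trace_smul, hx]
  -- If `M(x) = 0`, then `tr(N(x) N(g)) = tr(M(x) M(g)) = 0` for all `g`. The smaller kernel then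
  -- gives `M` rank at least `n²`.
  have hker : (matrixHom M).toLinearMap.ker ≤ (matrixHom N).toLinearMap.ker := by
    intro x hx
    have hx' : matrixHom M x = 0 := hx
    refine eq_zero_of_trace_mul_matrixHom hN fun g => ?_
    have := htr (x * MonoidAlgebra.single g 1)
    rw [map_mul, map_mul, hx', zero_mul, Matrix.trace_zero, matrixHom_single, one_smul] at this
    exact this.symm
  have : FiniteDimensional F F[G] := inferInstance
  have h1 := (matrixHom M).toLinearMap.finrank_range_add_finrank_ker
  have h2 := (matrixHom N).toLinearMap.finrank_range_add_finrank_ker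
  have h3 := Submodule.finrank_mono hker
  rw [LinearMap.range_eq_top.mpr hN, finrank_top] at h2
  have h4 : (matrixHom M).toLinearMap.range = ⊤ :=
    Submodule.eq_top_of_finrank_eq (le_antisymm (Submodule.finrank_le _) (by omega))
  exact LinearMap.range_eq_top.mp h4

end Reduction

/-! ### Height zero -/

/-- Conjugates have equal traces, with one conjugate for each coset of `D`. -/
theorem trace_matrixHom_relTrace {O G : Type*} [CommRing O] [Group G] [Finite G] {n : ℕ}
    (M : G →* Matrix (Fin n) (Fin n) O) (D : Subgroup G) (a : O[G]) :
    (matrixHom M (relTrace D a)).trace = D.index * (matrixHom M a).trace := by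
  have : Fintype (G ⧸ D) := Fintype.ofFinite _
  have h : ∀ x : G, (matrixHom M (MonoidAlgebra.of O G x * a * MonoidAlgebra.of O G x⁻¹)).trace =
      (matrixHom M a).trace := by
    intro x
    rw [map_mul, map_mul, Matrix.trace_mul_cycle, ← map_mul, ← map_mul (MonoidAlgebra.of O G), inv_mul_cancel,
      map_one, map_one, one_mul]
  rw [relTrace, finsum_eq_sum_of_fintype, map_sum, Matrix.trace_sum]
  rw [Finset.sum_congr rfl fun x _ => h x.out, Finset.sum_const, Finset.card_univ,
    Subgroup.index_eq_card, Nat.card_eq_fintype_card, nsmul_eq_mul]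

theorem trace_asAlgebraHom_mapRingHom {O K G : Type*} [CommRing O] [Field K] [Algebra O K]
    [Group G] {n : ℕ} {ρ : Representation K G (Fin n → K)} {M : G →* Matrix (Fin n) (Fin n) O}
    (hM : ∀ g, ρ.character g = algebraMap O K (M g).trace) (a : O[G]) :
    LinearMap.trace K _ (ρ.asAlgebraHom (MonoidAlgebra.mapRingHom G (algebraMap O K) a)) =
      algebraMap O K (matrixHom M a).trace := by
  induction a using MonoidAlgebra.induction_on with
  | of g => simpa [Representation.character] using hM g
  | add x y hx hy => simp only [map_add, Matrix.trace_add, hx, hy]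
  | smul r x hx =>
    have : MonoidAlgebra.mapRingHom G (algebraMap O K) (r • x) =
        algebraMap O K r • MonoidAlgebra.mapRingHom G (algebraMap O K) x := by
      ext g; simp [Algebra.smul_def]
    rw [this, map_smul, map_smul, hx, map_smul, Matrix.trace_smul, smul_eq_mul, smul_eq_mul,
      map_mul]

/-- A character of height zero takes a unit value. -/
theorem exists_isUnit_trace_of_hasHeight_zero {p : ℕ} [Fact p.Prime] {O K G : Type*} [CommRing O]
    [IsDomain O] [IsLocalRing O] [CharZero O] [CharP (IsLocalRing.ResidueField O) p] [Field K]
    [CharZero K] [Algebra O K] [FaithfulSMul O K] [Group G] [Finite G] {n : ℕ} (hn : n ≠ 0)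
    {ρ : Representation K G (Fin n → K)} {M : G →* Matrix (Fin n) (Fin n) O}
    (hM : ∀ g, ρ.character g = algebraMap O K (M g).trace) {b : O[G]}
    (hb : ρ.asAlgebraHom (MonoidAlgebra.mapRingHom G (algebraMap O K) b) = 1)
    (hht : HasHeight p b ρ.character 0) : ∃ g, IsUnit (M g).trace := by
  obtain ⟨D, ⟨⟨a, -, rfl⟩, -⟩, n', hn', hval⟩ := hht
  have hinj := FaithfulSMul.algebraMap_injective O K
  obtain rfl : n = n' := by
    rw [hM, map_one, Matrix.trace_one, Fintype.card_fin, map_natCast] at hn'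
    exact_mod_cast hn'
  have hcop : ∀ m : ℕ, ¬ p ∣ m → IsUnit (m : O) := fun m hm => by
    rw [← IsLocalRing.residue_ne_zero_iff_isUnit, map_natCast, Ne,
      CharP.cast_eq_zero_iff (IsLocalRing.ResidueField O) p]
    exact hm
  have hp1 : p ≠ 1 := (Fact.out : p.Prime).ne_one
  -- Since `b` acts as the identity, its trace is `n`.
  have hdeg : (n : O) = D.index * (matrixHom M a).trace := by
    rw [← trace_matrixHom_relTrace]
    apply hinj
    rw [← trace_asAlgebraHom_mapRingHom hM, hb, LinearMap.trace_one]
    simp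
  have hindex : D.index ≠ 0 := Subgroup.index_ne_zero_of_finite
  have hval' : padicValNat p n = padicValNat p D.index := by
    rw [← D.card_mul_index, padicValNat.mul Nat.card_pos.ne' hindex] at hval
    omega
  obtain ⟨r, m, hm, hnm⟩ := Nat.exists_eq_pow_mul_and_not_dvd hn p hp1
  obtain ⟨r', m', hm', hnm'⟩ := Nat.exists_eq_pow_mul_and_not_dvd hindex p hp1
  have hv : ∀ r m : ℕ, ¬ p ∣ m → padicValNat p (p ^ r * m) = r := fun r m hm => by
    rw [padicValNat.mul (pow_ne_zero _ (Fact.out : p.Prime).ne_zero)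
      (by rintro rfl; exact hm (dvd_zero p)), padicValNat.prime_pow,
      padicValNat.eq_zero_of_not_dvd hm, add_zero]
  rw [hnm, hnm', hv _ _ hm, hv _ _ hm'] at hval'
  subst hval'
  -- Height zero makes the `p`-parts of `n` and `|G:D|` equal; cancelling them leaves the `p'`-part
  -- `m`, a unit.
  have hmm : (m : O) = m' * (matrixHom M a).trace := by
    have hp0 : ((p : O) ^ r) ≠ 0 :=
      pow_ne_zero _ (by exact_mod_cast (Fact.out : p.Prime).ne_zero)
    apply mul_left_cancel₀ hp0
    have h1 : (n : O) = (p : O) ^ r * m := by exact_mod_cast congrArg (Nat.cast : ℕ → O) hnm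
    have h2 : (D.index : O) = (p : O) ^ r * m' := by
      exact_mod_cast congrArg (Nat.cast : ℕ → O) hnm'
    rw [← h1, hdeg, h2, mul_assoc]
  have hunit : IsUnit (matrixHom M a).trace :=
    isUnit_of_mul_isUnit_right (hmm ▸ hcop m hm)
  by_contra! hno
  have hmem : ∀ x : O[G], (matrixHom M x).trace ∈ IsLocalRing.maximalIdeal O := by
    intro x
    induction x using MonoidAlgebra.induction_on with
    | of g => simpa using hno g
    | add x y hx hy => rw [map_add, Matrix.trace_add]; exact Ideal.add_mem _ hx hy
    | smul r x hx => rw [map_smul, Matrix.trace_smul]; exact Ideal.mul_mem_left _ _ hx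
  exact (IsLocalRing.mem_maximalIdeal _).mp (hmem a) hunit

/-! ### Brauer characters of reductions -/

section Brauer

open IsLocalRing

variable {O K : Type*} [CommRing O] [IsDomain O] [IsLocalRing O] [Field K] [Algebra O K]

/-- The lifted trace is integral and reduces to the trace. -/
theorem IsLiftedTrace.residue_eq_trace [FaithfulSMul O K] {n : ℕ}
    {f : Module.End (ResidueField O) (Fin n → ResidueField O)} {m : ℕ} {r : O}
    (h : IsLiftedTrace f m (algebraMap O K r)) :
    residue O r = LinearMap.trace (ResidueField O) _ f := by
  obtain ⟨F, hF, hmap, -, hsum⟩ := h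
  have hinj : Function.Injective (algebraMap O (AlgebraicClosure K)) := by
    rw [IsScalarTower.algebraMap_eq O K]
    exact (algebraMap K _).injective.comp (FaithfulSMul.algebraMap_injective O K)
  -- By Vieta the sum of the roots is minus the next coefficient, which lies in `O` and can be
  -- reduced.
  have h1 : r = -F.nextCoeff := by
    apply hinj
    rw [IsScalarTower.algebraMap_apply O K, hsum, Polynomial.aroots, map_neg,
      ← Polynomial.nextCoeff_map hinj,
      (IsAlgClosed.splits _).nextCoeff_eq_neg_sum_roots_of_monic (hF.map _), neg_neg]
  rw [h1, LinearMap.trace_eq_matrix_trace _ (Pi.basisFun _ (Fin n)),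
    Matrix.trace_eq_neg_charpoly_nextCoeff, LinearMap.charpoly_toMatrix, ← hmap, map_neg]
  simp only [Polynomial.nextCoeff, hF.natDegree_map, Polynomial.coeff_map]
  split_ifs <;> simp

/-- With exponent 1 every root is 1. This recovers the degree from the value at the identity. -/
theorem IsLiftedTrace.eq_natCast [FaithfulSMul O K] {n : ℕ}
    {f : Module.End (ResidueField O) (Fin n → ResidueField O)} {t : K}
    (h : IsLiftedTrace (O := O) f 1 t) : t = n := by
  obtain ⟨F, hF, hmap, hroots, hsum⟩ := h
  apply (algebraMap K (AlgebraicClosure K)).injective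
  have hcard : (F.aroots (AlgebraicClosure K)).card = n := by
    rw [Polynomial.aroots, ← (IsAlgClosed.splits _).natDegree_eq_card_roots, hF.natDegree_map,
      ← hF.natDegree_map (residue O), hmap, LinearMap.charpoly_natDegree, Module.finrank_fin_fun]
  have h1 : ∀ z ∈ F.aroots (AlgebraicClosure K), z = 1 := fun z hz => by simpa using hroots z hz
  rw [hsum, Multiset.eq_replicate_of_mem h1, hcard]
  simp

/-- The characteristic polynomial of `A` itself is the required lift. -/
theorem isLiftedTrace_residue {n m : ℕ} (A : Matrix (Fin n) (Fin n) O) (hA : A ^ m = 1) :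
    IsLiftedTrace (O := O) (K := K) (Matrix.toLinAlgEquiv' (A.map (residue O))) m
      (algebraMap O K A.trace) := by
  refine ⟨A.charpoly, A.charpoly_monic, ?_, ?_, ?_⟩
  · rw [← Matrix.charpoly_map]
    exact (Matrix.charpoly_toLin' _).symm
  · intro z hz
    rw [Polynomial.aroots, ← Matrix.charpoly_map] at hz
    have h1 := spectrum.pow_mem_pow _ m
      (Matrix.mem_spectrum_of_isRoot_charpoly (Polynomial.isRoot_of_mem_roots hz))
    -- For `n = 0` the matrix ring is trivial and the spectrum is empty, so no root exists.
    have : Nontrivial (Matrix (Fin n) (Fin n) (AlgebraicClosure K)) := by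
      by_contra h
      rw [not_nontrivial_iff_subsingleton] at h
      simp [spectrum.of_subsingleton] at h1
    rw [← RingHom.mapMatrix_apply, ← map_pow, hA, map_one, spectrum.one_eq] at h1
    exact h1
  · rw [Polynomial.aroots, ← Matrix.charpoly_map, ← Matrix.trace_eq_sum_roots_charpoly,
      map_trace_eq, ← IsScalarTower.algebraMap_apply]

end Brauer

/-! ### Assembling the equivalence -/

/-- `OG e(χ)` as a quotient of `OG`. -/
def toCharAlgebra (O : Type*) {K G : Type*} [CommRing O] [Field K] [CharZero K] [Algebra O K]
    [Group G] [Fintype G] (hK : IsSplittingFieldFor K G) (χ : G → K) (hχ : χ ∈ IrrK K G) :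
    O[G] →ₗ[O] charAlgebra O hK χ hχ where
  toFun a := ⟨MonoidAlgebra.mapRingHom G (algebraMap O K) a * charIdempotent χ, a, rfl⟩
  map_add' a b := Subtype.ext (by simp [add_mul])
  map_smul' r a := Subtype.ext (by
    change MonoidAlgebra.mapRingHom G (algebraMap O K) (r • a) * charIdempotent χ =
      r • (MonoidAlgebra.mapRingHom G (algebraMap O K) a * charIdempotent χ)
    rw [← smul_mul_assoc]
    congr 1
    ext g
    simp [Algebra.smul_def])

section

variable {O K G : Type*} [CommRing O] [Field K] [CharZero K] [Algebra O K] [Group G] [Fintype G]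
  {hK : IsSplittingFieldFor K G} {χ : G → K} {hχ : χ ∈ IrrK K G}

theorem toCharAlgebra_surjective : Function.Surjective (toCharAlgebra O hK χ hχ) := by
  rintro ⟨_, a, rfl⟩
  exact ⟨a, rfl⟩

theorem toCharAlgebra_mul (a b : O[G]) :
    toCharAlgebra O hK χ hχ (a * b) = toCharAlgebra O hK χ hχ a * toCharAlgebra O hK χ hχ b := by
  apply Subtype.ext
  change MonoidAlgebra.mapRingHom G (algebraMap O K) (a * b) * charIdempotent χ =
    MonoidAlgebra.mapRingHom G (algebraMap O K) a * charIdempotent χ *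
      (MonoidAlgebra.mapRingHom G (algebraMap O K) b * charIdempotent χ)
  rw [map_mul, mul_assoc, mul_assoc, ← mul_assoc (charIdempotent χ), charIdempotent_comm hχ,
    mul_assoc, (isIdempotentElem_charIdempotent hK hχ).eq]

end

theorem dim_ne_zero_of_isIrreducible {F G : Type*} [Field F] [Group G] {n : ℕ}
    {ρ : Representation F G (Fin n → F)} (hρ : ρ.IsIrreducible) : n ≠ 0 := by
  rintro rfl
  obtain ⟨a, b, hab⟩ := hρ.toNontrivial
  exact hab (SetLike.ext fun x => by
    rw [Subsingleton.elim x 0]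
    exact ⟨fun _ => b.toSubmodule.zero_mem, fun _ => a.toSubmodule.zero_mem⟩)

/-- The reduction of an integral matrix representation spans all matrices if and only if its
character lifts an irreducible Brauer character. -/
theorem matrixHom_surjective_iff_liftsIrreducibleBrauer {p : ℕ} [Fact p.Prime] {O K G : Type*}
    [CommRing O] [IsDomain O] [IsLocalRing O] [CharP (IsLocalRing.ResidueField O) p] [Field K]
    [CharZero K] [Algebra O K] [FaithfulSMul O K] [Group G] [Finite G]
    (hk : IsSplittingFieldFor (IsLocalRing.ResidueField O) G) {n : ℕ} (hn : n ≠ 0)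
    {χ : G → K} {M : G →* Matrix (Fin n) (Fin n) O}
    (hM : ∀ g, χ g = algebraMap O K (M g).trace) :
    Function.Surjective (matrixHom M) ↔ LiftsIrreducibleBrauer O p χ := by
  constructor
  · intro h
    refine ⟨_, ⟨n, ofMatrixRep (mapRep (IsLocalRing.residue O) M),
      isIrreducible_ofMatrixRep hn (matrixHom_residue_surjective h), fun g => ?_⟩, rfl⟩
    rw [decompositionMap, hM]
    exact isLiftedTrace_residue _ (by rw [← map_pow, pow_orderOf_eq_one, map_one])
  · rintro ⟨φ, ⟨m, τ, hτ, hφ⟩, rfl⟩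
    simp only [decompositionMap, hM] at hφ
    obtain rfl : n = m := by
      have hp : ¬ p ∣ orderOf (1 : G) := by
        rw [orderOf_one, Nat.dvd_one]; exact (Fact.out : p.Prime).ne_one
      have := hφ ⟨1, hp⟩
      simp only [orderOf_one] at this
      have := this.eq_natCast
      rw [map_one, Matrix.trace_one, Fintype.card_fin, map_natCast] at this
      exact_mod_cast this
    -- The reduction of `M` and `τ` have equal traces on `p`-regular elements, hence on all of `G`;
    -- `τ` spans all matrices as `k` is a splitting field.
    refine matrixHom_surjective_of_residue (matrixHom_surjective_of_trace_eq
      (matrixHom_toMatrixRep_surjective hk τ hτ) fun g => ?_)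
    obtain ⟨h, hh, htr⟩ := trace_eq_of_pRegular (F := IsLocalRing.ResidueField O) p g
    rw [htr, htr, mapRep_apply, map_trace_eq, (hφ ⟨h, hh⟩).residue_eq_trace, trace_toMatrixRep]
    rfl

end BlockTheory

end

theorem corollary1p5 (p : ℕ) [Fact p.Prime]
    (O : Type*) [CommRing O] [IsDomain O] [IsDiscreteValuationRing O]
    [IsAdicComplete (IsLocalRing.maximalIdeal O) O] [CharP (IsLocalRing.ResidueField O) p]
    (K : Type*) [Field K] [CharZero K] [Algebra O K] [IsFractionRing O K]
    (G : Type*) [Group G] [Fintype G]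
    (hK : BlockTheory.IsSplittingFieldFor K G) (hk : BlockTheory.IsSplittingFieldFor (IsLocalRing.ResidueField O) G)
    (b : MonoidAlgebra O G) (hb : BlockTheory.IsBlockIdempotent b)
    (χ : G → K) (hχ : χ ∈ BlockTheory.IrrKBlock K b) (hht : BlockTheory.HasHeight p b χ 0) :
    BlockTheory.IsSymmetricAlgebra O (BlockTheory.charAlgebra O hK χ (BlockTheory.IrrKBlock_subset b hχ)) ↔
      BlockTheory.LiftsIrreducibleBrauer O p χ := by
  have hχ' := hχ
  obtain ⟨n, ρ, hρ, hbρ, rfl⟩ := hχ'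
  have hn : n ≠ 0 := BlockTheory.dim_ne_zero_of_isIrreducible hρ
  have : FaithfulSMul O K :=
    (faithfulSMul_iff_algebraMap_injective O K).mpr (IsFractionRing.injective O K)
  have : CharZero O := ⟨fun a b h => by
    have := congrArg (algebraMap O K) h
    simpa using this⟩
  obtain ⟨M, hMK, hM⟩ := BlockTheory.exists_matrixRep O hK ρ hρ
  obtain ⟨g, hg⟩ := BlockTheory.exists_isUnit_trace_of_hasHeight_zero hn hM hbρ hht
  let Ψ := BlockTheory.toCharAlgebra O hK ρ.character (BlockTheory.IrrKBlock_subset b hχ)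
  have hker : ∀ a, Ψ a = 0 ↔ BlockTheory.matrixHom M a = 0 := fun a => by
    rw [← BlockTheory.mul_charIdempotent_eq_zero_iff hn hMK hM a]
    exact Subtype.ext_iff
  rw [← BlockTheory.matrixHom_surjective_iff_liftsIrreducibleBrauer hk hn hM]
  exact ⟨BlockTheory.surjective_of_isSymmetricAlgebra hn hMK Ψ
      BlockTheory.toCharAlgebra_surjective BlockTheory.toCharAlgebra_mul hker hg,
    BlockTheory.isSymmetricAlgebra_of_surjective Ψ
      BlockTheory.toCharAlgebra_surjective BlockTheory.toCharAlgebra_mul hker⟩
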